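/- Let $\nu\ge 1$ and $g\ge 0$ be integers. Let $L=A_0+A_1x_1+\cdots+A_gx_g\in\mathbb R^{\nu\times\nu}[x]$ be a linear pencil in commuting variables $x=(x_1,\dots,x_g)$, that is, all $A_i$ are real symmetric $\nu\times\nu$ matrices ($A_0$ is arbitrary symmetric). Let $\mathbb R\langle x,x^*\rangle$ be the free real algebra on the $2g$ letters $x_i,x_i^*$, with the involution $*$ that exchanges $x_i$ and $x_i^*$ and satisfies $(pq)^*=q^*p^*$; on matrices over $\mathbb R\langle x,x^*\rangle$ the involution transposes and acts entrywise. The *commutative collapse* is the algebra homomorphism $\mathbb R\langle x,x^*\rangle\to\mathbb R[x]$ with $x_i\mapsto x_i$, $x_i^*\mapsto x_i$. Let $L_0\in\mathbb R^{\nu\times\nu}\langle x,x^*\rangle$ be any symmetric ($L_0^*=L_0$) matrix of noncommutative polynomials of degree at most $1$ whose entrywise commutative collapse is $L$; for example $L_0=A_0+\tfrac12\sum_i A_ix_i+\tfrac12\sum_iA_ix_i^*$. A left ideal $J\subseteq\mathbb R\langle x,x^*\rangle$ is called *$L_0$-real* if, whenever $\sum_i p_i^*p_i+\sum_j q_j^*L_0q_j\in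 J+J^*$ for finitely many $p_i\in\mathbb R\langle x,x^*\rangle$ and $q_j\in\mathbb R^{\nu\times1}\langle x,x^*\rangle$, every $p_i$ lies in $J$ and all entries of every $L_0q_j$ lie in $J$. Let $\sqrt[L_0]{\{0\}}$ be the $L_0$-real radical of $\{0\}$, i.e. the intersection of all $L_0$-real left ideals, and let $I\subseteq\mathbb R[x]$ be its image under the commutative collapse. Then: 1. $I$ is an ideal of $\mathbb R[x]$, and it is generated by polynomials of degree at most $1$. 2. There are an integer $\nu'$ with $1\le\nu'\le\nu$ and a linear pencil $\tilde L\in\mathbb R^{\nu'\times\nu'}[x]$ such that $\{x\in\mathbb R^g\mid\tilde L(x)\succeq0\}$ has nonempty interior in $\mathbb R^g$ and $$\{x\in\mathbb R^g\mid L(x)\succeq0\}=\{x\in\mathbb R^g\mid\tilde L(x)\succeq0\text{ and }\iota(x)=0\text{ for each }\iota\in I\}.$$ -/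

import Mathlib

/-- The algebra `ℝ⟨x, x*⟩` of noncommutative polynomials in the `2g` free letters `x₁, …, x_g`
(the letters `Sum.inl i`) and `x₁*, …, x_g*` (the letters `Sum.inr i`): formal real linear
combinations of words. -/
abbrev NCPoly (g : ℕ) : Type := MonoidAlgebra ℝ (FreeMonoid (Fin g ⊕ Fin g))

/-- The involution on words: reverse the word and exchange `xᵢ` with `xᵢ*`. -/
def wordStar {g : ℕ} (w : FreeMonoid (Fin g ⊕ Fin g)) : FreeMonoid (Fin g ⊕ Fin g) :=
  FreeMonoid.reverse (FreeMonoid.map Sum.swap w)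

/-- The involution `p ↦ p*` on `ℝ⟨x, x*⟩`: the linear extension of the involution on words. -/
noncomputable def ncStar {g : ℕ} (p : NCPoly g) : NCPoly g :=
  MonoidAlgebra.mapDomain wordStar p

/-- A noncommutative linear pencil of size `ν`: a matrix `L` of noncommutative polynomials which is
symmetric, `L* = L` (the involution transposes the matrix and applies `p ↦ p*` to the entries), and
in which only words of length at most one occur. -/
def IsNCLinearPencil {g ν : ℕ} (L : Matrix (Fin ν) (Fin ν) (NCPoly g)) : Prop :=
  (L.map ncStar).transpose = L ∧
    ∀ i j, ∀ w ∈ (L i j).coeff.support, FreeMonoid.length w ≤ 1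

/-- A linear pencil of size `ν` in commuting variables `x₁, …, x_g`: a symmetric matrix of real
polynomials of degree at most one, i.e. `A₀ + A₁ x₁ + ⋯ + A_g x_g` with symmetric `Aᵢ`. -/
def IsLinearPencil {g ν : ℕ} (L : Matrix (Fin ν) (Fin ν) (MvPolynomial (Fin g) ℝ)) : Prop :=
  L.transpose = L ∧ ∀ i j, (L i j).totalDegree ≤ 1

/-- The spectrahedron (positivity set) `{x ∈ ℝ^g | L(x) ⪰ 0}`. -/
def spectrahedron {g ν : ℕ} (L : Matrix (Fin ν) (Fin ν) (MvPolynomial (Fin g) ℝ)) :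
    Set (Fin g → ℝ) :=
  {x | (L.map (MvPolynomial.eval x)).PosSemidef}

/-- A left ideal `I` of `ℝ⟨x, x*⟩` is `L`-real if, whenever
`∑ pᵢ* pᵢ + ∑ qⱼ* L qⱼ ∈ I + I*` for finitely many polynomials `pᵢ` and finitely many columns `qⱼ`
of polynomials, all `pᵢ` lie in `I` and all columns `L qⱼ` have their entries in `I`.
(`Ideal` means left ideal in a noncommutative ring.) -/
def IsLReal {g ν : ℕ} (L : Matrix (Fin ν) (Fin ν) (NCPoly g)) (I : Ideal (NCPoly g)) : Prop :=
  ∀ (m k : ℕ) (p : Fin m → NCPoly g) (q : Fin k → Fin ν → NCPoly g),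
    (∃ a ∈ I, ∃ b ∈ I,
      (∑ i, ncStar (p i) * p i) + (∑ j, ∑ s, ∑ t, ncStar (q j s) * L s t * q j t)
        = a + ncStar b) →
    (∀ i, p i ∈ I) ∧ ∀ j s, L.mulVec (q j) s ∈ I

/-- The `L`-real radical of a left ideal `I`: the intersection of all `L`-real left ideals
containing `I`. -/
noncomputable def lRealRadical {g ν : ℕ} (L : Matrix (Fin ν) (Fin ν) (NCPoly g))
    (I : Ideal (NCPoly g)) : Ideal (NCPoly g) :=
  sInf {J | I ≤ J ∧ IsLReal L J}

/-- The commutative collapse `ℝ⟨x, x*⟩ → ℝ[x]`: let the variables commute and set `xᵢ* = xᵢ`. -/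
noncomputable def collapse {g : ℕ} : NCPoly g →ₐ[ℝ] MvPolynomial (Fin g) ℝ :=
  MonoidAlgebra.lift ℝ (MvPolynomial (Fin g) ℝ) (FreeMonoid (Fin g ⊕ Fin g))
    (FreeMonoid.lift (Sum.elim MvPolynomial.X MvPolynomial.X))

/-! Let `R` be the radical, `U` the collapses of its affine elements and `Z` the affine subspace cut
out by `U`. Evaluation at a point of the spectrahedron has an `L₀`-real kernel, so `I` vanishes on
the spectrahedron, which therefore lies in `Z`. If `1 ∈ U`, the spectrahedron is empty and the
identity pencil serves as `Lt`.

Otherwise the spectrahedron contains a nonempty relatively open subset of `Z`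
(`IsLReal.exists_isOpen_inter_subset_spectrahedron`). Let `P` project onto the common kernel of all
`L(x)`, `x ∈ Z`. If no `L(x) + P` were positive definite, `exists_separating_gram` would give `B ≠
0` with `∑ Bₖᵀ (L(x) + P) Bₖ ≤ 0` on `Z`. Then `∑ Bₖᵀ L Bₖ` is bounded above on `Z`, hence a
constant `-c` with `c ≥ 0`. Realness of `R` forces `c = 0` and `L Bₖ = 0` on `Z`, so `P Bₖ = Bₖ` and
`∑ |Bₖ|² ≤ 0`: a contradiction.

With an affine projection `π` onto `Z`, the pencil `L ∘ π` has a spectrahedron with interior. For `f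
∈ I`, `f ∘ π` vanishes on an open set, so it is zero, and `f = f - f ∘ π` lies in the ideal
generated by the `Xᵢ - πᵢ ∈ U`. -/

/-! ### Positive definite matrices and their separation from convex sets. -/

open Matrix in
/-- The real square matrices, not necessarily symmetric, with positive quadratic form. -/
def posForms (n : ℕ) : Set (Matrix (Fin n) (Fin n) ℝ) :=
  {M | ∀ v : Fin n → ℝ, v ≠ 0 → 0 < v ⬝ᵥ M *ᵥ v}

open Matrix in
theorem smul_dotProduct_mulVec_smul {n : ℕ} (M : Matrix (Fin n) (Fin n) ℝ) (c : ℝ)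
    (v : Fin n → ℝ) : (c • v) ⬝ᵥ M *ᵥ (c • v) = c ^ 2 * (v ⬝ᵥ M *ᵥ v) := by
  simp only [mulVec_smul, smul_dotProduct, dotProduct_smul, smul_eq_mul]
  ring

open Matrix in
theorem mem_posForms_iff_sphere {n : ℕ} {M : Matrix (Fin n) (Fin n) ℝ} :
    M ∈ posForms n ↔ ∀ v ∈ Metric.sphere (0 : Fin n → ℝ) 1, 0 < v ⬝ᵥ M *ᵥ v := by
  constructor
  · intro h v hv
    exact h v (ne_zero_of_mem_unit_sphere ⟨v, hv⟩)
  · intro h v hv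
    have hn : 0 < ‖v‖ := norm_pos_iff.2 hv
    have h1 := h (‖v‖⁻¹ • v) (by simp [norm_smul, hn.ne'])
    rw [smul_dotProduct_mulVec_smul] at h1
    exact pos_of_mul_pos_right h1 (by positivity)

-- By homogeneity only the compact unit sphere matters, and a strict inequality on a compact set
-- persists under small perturbation.
open Matrix in
theorem isOpen_posForms (n : ℕ) : IsOpen (posForms n) := by
  have h : posForms n =
      {M | ∀ v ∈ Metric.sphere (0 : Fin n → ℝ) 1, 0 < v ⬝ᵥ M *ᵥ v} := by
    ext M; exact mem_posForms_iff_sphere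
  rw [h, isOpen_iff_eventually]
  intro M hM
  refine (isCompact_sphere (0 : Fin n → ℝ) 1).eventually_forall_of_forall_eventually ?_
  intro v hv
  have hc : Continuous fun z : Matrix (Fin n) (Fin n) ℝ × (Fin n → ℝ) => z.2 ⬝ᵥ z.1 *ᵥ z.2 := by
    fun_prop
  exact hc.continuousAt.eventually (lt_mem_nhds (hM v hv))

open Matrix in
theorem convex_posForms (n : ℕ) : Convex ℝ (posForms n) := by
  rw [convex_iff_forall_pos]
  intro M hM N hN a b ha hb _ v hv
  have h1 := mul_pos ha (hM v hv)
  have h2 := mul_pos hb (hN v hv)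
  simp only [add_mulVec, smul_mulVec, dotProduct_add, dotProduct_smul, smul_eq_mul]
  linarith

open Matrix in
theorem one_mem_posForms (n : ℕ) : (1 : Matrix (Fin n) (Fin n) ℝ) ∈ posForms n := by
  intro v hv
  rw [one_mulVec]
  simpa using dotProduct_self_star_pos_iff.2 hv

open Matrix in
theorem smul_mem_posForms {n : ℕ} {M : Matrix (Fin n) (Fin n) ℝ} (hM : M ∈ posForms n) {c : ℝ}
    (hc : 0 < c) : c • M ∈ posForms n := by
  intro v hv
  simpa [smul_mulVec, dotProduct_smul] using mul_pos hc (hM v hv)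

theorem matrix_geometric_hahn_banach_open {n : ℕ} {s t : Set (Matrix (Fin n) (Fin n) ℝ)}
    (hs : Convex ℝ s) (hso : IsOpen s) (ht : Convex ℝ t) (hd : Disjoint s t) :
    ∃ (f : Matrix (Fin n) (Fin n) ℝ →ₗ[ℝ] ℝ) (u : ℝ), (∀ a ∈ s, f a < u) ∧ ∀ b ∈ t, u ≤ f b := by
  obtain ⟨f, u, h⟩ := geometric_hahn_banach_open (E := Matrix (Fin n) (Fin n) ℝ) hs hso ht hd
  exact ⟨f.toLinearMap, u, h⟩

open Matrix in
/-- A linear functional on matrices, restricted to symmetric matrices, is the trace form of a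
symmetric matrix. -/
theorem linearMap_eq_sum_of_symm {n : ℕ} (f : Matrix (Fin n) (Fin n) ℝ →ₗ[ℝ] ℝ)
    {M : Matrix (Fin n) (Fin n) ℝ} (hM : Mᵀ = M) :
    f M = ∑ i, ∑ j, M i j * ((f (single i j 1) + f (single j i 1)) / 2) := by
  have h : ∀ N : Matrix (Fin n) (Fin n) ℝ, f N = ∑ i, ∑ j, N i j * f (single i j 1) := by
    intro N
    conv_lhs => rw [matrix_eq_sum_single N]
    simp only [map_sum]
    refine Finset.sum_congr rfl fun i _ => Finset.sum_congr rfl fun j _ => ?_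
    rw [← smul_eq_mul, ← map_smul, smul_single, smul_eq_mul, mul_one]
  have h2 : f M = ∑ i, ∑ j, M i j * f (single j i 1) := by
    rw [h M, Finset.sum_comm]
    refine Finset.sum_congr rfl fun i _ => Finset.sum_congr rfl fun j _ => ?_
    rw [← congrFun (congrFun hM i) j, transpose_apply]
  have h3 : f M = (f M + f M) / 2 := by ring
  rw [h3]
  nth_rewrite 1 [h M]
  rw [h2, ← Finset.sum_add_distrib, Finset.sum_div]
  refine Finset.sum_congr rfl fun i _ => ?_
  rw [← Finset.sum_add_distrib, Finset.sum_div]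
  refine Finset.sum_congr rfl fun j _ => ?_
  ring

open scoped MatrixOrder Matrix.Norms.L2Operator in
theorem Matrix.PosSemidef.exists_eq_star_mul_self {n : ℕ} {M : Matrix (Fin n) (Fin n) ℝ}
    (hM : M.PosSemidef) : ∃ B : Matrix (Fin n) (Fin n) ℝ, M = star B * B :=
  CStarAlgebra.nonneg_iff_eq_star_mul_self.mp hM.nonneg

open Matrix in
/-- A convex set of symmetric matrices without positive definite elements is weakly separated from
the positive definite matrices by a nonzero positive semidefinite matrix `Bᵀ B`. -/
theorem exists_separating_gram {n : ℕ} {t : Set (Matrix (Fin n) (Fin n) ℝ)} (ht : Convex ℝ t)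
    (hne : t.Nonempty) (hsymm : ∀ M ∈ t, Mᵀ = M) (hd : Disjoint (posForms n) t) :
    ∃ B : Matrix (Fin n) (Fin n) ℝ, B ≠ 0 ∧ ∀ M ∈ t, ∑ k, B k ⬝ᵥ M *ᵥ B k ≤ 0 := by
  obtain ⟨f, u, hs, hu⟩ :=
    matrix_geometric_hahn_banach_open (convex_posForms n) (isOpen_posForms n) ht hd
  have hneg : ∀ M ∈ posForms n, f M ≤ 0 := by
    intro M hM
    by_contra! h
    -- A functional bounded above on a cone is nonpositive there: this multiple of `M` has value
    -- `|u| + 1`.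
    have h1 := hs _ (smul_mem_posForms hM (c := (|u| + 1) / f M) (by positivity))
    rw [map_smul, smul_eq_mul, div_mul_cancel₀ _ h.ne'] at h1
    linarith [le_abs_self u]
  have hu0 : 0 ≤ u := by
    by_contra! h
    have h1 := hneg 1 (one_mem_posForms n)
    -- The multiple of the identity is small enough that `f` exceeds `u` on it.
    have hc : 0 < -u / (1 - f 1) := div_pos (by linarith) (by linarith)
    have h2 := hs _ (smul_mem_posForms (one_mem_posForms n) hc)
    rw [map_smul, smul_eq_mul, div_mul_eq_mul_div, div_lt_iff₀ (by linarith)] at h2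
    linarith
  have hrank : ∀ v : Fin n → ℝ, f (vecMulVec v v) ≤ 0 := by
    intro v
    refine le_of_forall_pos_le_add fun ε hε => ?_
    have hc : 0 < ε / (1 - f 1) := div_pos hε (by linarith [hneg 1 (one_mem_posForms n)])
    -- A rank-one matrix is a limit of positive definite ones; the factor keeps the error in `f`
    -- within `ε`.
    have h1 := hneg (vecMulVec v v + (ε / (1 - f 1)) • 1) (by
      intro w hw
      have h2 := smul_mem_posForms (one_mem_posForms n) hc w hw
      have h3 : w ⬝ᵥ vecMulVec v v *ᵥ w = (v ⬝ᵥ w) ^ 2 := by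
        simp [vecMulVec_mulVec, dotProduct_smul, dotProduct_comm w v, sq]
      rw [add_mulVec, dotProduct_add, h3]
      positivity)
    rw [map_add, map_smul, smul_eq_mul] at h1
    have h4 : ε / (1 - f 1) * f 1 ≥ -ε := by
      rw [div_mul_eq_mul_div, ge_iff_le, le_div_iff₀ (by linarith [hneg 1 (one_mem_posForms n)])]
      nlinarith
    linarith
  set G : Matrix (Fin n) (Fin n) ℝ :=
    Matrix.of fun i j => -((f (single i j 1) + f (single j i 1)) / 2) with hG
  have hfG : ∀ M : Matrix (Fin n) (Fin n) ℝ, Mᵀ = M → f M = -∑ i, ∑ j, M i j * G i j := by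
    intro M hM
    rw [linearMap_eq_sum_of_symm f hM]
    simp [hG, Finset.sum_neg_distrib]
  have hpsd : G.PosSemidef := by
    refine .of_dotProduct_mulVec_nonneg ?_ fun v => ?_
    · ext i j
      simp [hG, add_comm]
    · have h1 := hrank v
      rw [hfG _ (by ext i j; simp [vecMulVec_apply, mul_comm])] at h1
      have h2 : star v ⬝ᵥ G *ᵥ v = ∑ i, ∑ j, vecMulVec v v i j * G i j := by
        simp only [star_trivial, dotProduct, mulVec, Finset.mul_sum, vecMulVec_apply]
        refine Finset.sum_congr rfl fun i _ => Finset.sum_congr rfl fun j _ => ?_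
        ring
      rw [h2]
      linarith
  obtain ⟨B, hB⟩ := hpsd.exists_eq_star_mul_self
  have hfB : ∀ M : Matrix (Fin n) (Fin n) ℝ, Mᵀ = M → f M = -∑ k, B k ⬝ᵥ M *ᵥ B k := by
    intro M hM
    rw [hfG M hM, hB]
    congr 1
    simp only [star_eq_conjTranspose, mul_apply, conjTranspose_apply, star_trivial, dotProduct,
      mulVec, Finset.mul_sum]
    rw [Finset.sum_comm' (t' := Finset.univ) (s' := fun _ => Finset.univ) (by simp)]
    rw [Finset.sum_congr rfl fun j _ => Finset.sum_comm, Finset.sum_comm]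
    refine Finset.sum_congr rfl fun k _ => ?_
    rw [Finset.sum_comm]
    refine Finset.sum_congr rfl fun i _ => Finset.sum_congr rfl fun j _ => ?_
    ring
  refine ⟨B, ?_, fun M hM => ?_⟩
  -- If `B = 0`, then `f` vanishes on symmetric matrices, against `f 1 < u ≤ f M`.
  · rintro rfl
    obtain ⟨M, hM⟩ := hne
    have h1 := hu M hM
    have h2 := hs 1 (one_mem_posForms n)
    rw [hfB M (hsymm M hM)] at h1
    rw [hfB 1 transpose_one] at h2
    have h3 : ∀ k, (0 : Matrix (Fin n) (Fin n) ℝ) k = 0 := fun k => rfl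
    simp only [h3, zero_dotProduct, Finset.sum_const_zero, neg_zero] at h1 h2
    linarith
  · have h1 := hu M hM
    rw [hfB M (hsymm M hM)] at h1
    linarith

open Matrix in
/-- The matrix of the orthogonal projection onto a subspace. -/
theorem exists_orthogonal_projection_matrix {n : ℕ} (K : Submodule ℝ (Fin n → ℝ)) :
    ∃ P : Matrix (Fin n) (Fin n) ℝ, Pᵀ = P ∧ (∀ v, P *ᵥ v ∈ K) ∧ ∀ v ∈ K, P *ᵥ v = v := by
  let e : EuclideanSpace ℝ (Fin n) ≃ₗ[ℝ] (Fin n → ℝ) := WithLp.linearEquiv 2 ℝ (Fin n → ℝ)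
  let K' := K.comap e.toLinearMap
  let T : (Fin n → ℝ) →ₗ[ℝ] (Fin n → ℝ) :=
    e.toLinearMap ∘ₗ K'.starProjection.toLinearMap ∘ₗ e.symm.toLinearMap
  have hT : ∀ v, LinearMap.toMatrix' T *ᵥ v = T v := fun v => by
    rw [← Matrix.toLin'_apply, Matrix.toLin'_toMatrix']
  refine ⟨LinearMap.toMatrix' T, ?_, fun v => ?_, fun v hv => ?_⟩
  · have hin : ∀ v w : Fin n → ℝ, v ⬝ᵥ T w = T v ⬝ᵥ w := by
      intro v w
      have h := K'.inner_starProjection_left_eq_right (e.symm v) (e.symm w)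
      simp only [EuclideanSpace.inner_eq_star_dotProduct, star_trivial] at h
      rw [dotProduct_comm (T v)]
      rw [dotProduct_comm v]
      exact h.symm
    ext i j
    have h := hin (Pi.single i 1) (Pi.single j 1)
    rw [transpose_apply, LinearMap.toMatrix'_apply, LinearMap.toMatrix'_apply]
    simpa [dotProduct_single] using h.symm
  · rw [hT]
    exact K'.starProjection_apply_mem (e.symm v)
  · rw [hT]
    have h : K'.starProjection (e.symm v) = e.symm v :=
      Submodule.starProjection_eq_self_iff.2 (by simpa [K'] using hv)
    change e (K'.starProjection (e.symm v)) = v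
    rw [h, LinearEquiv.apply_symm_apply]

/-! ### Affine polynomials, the involution and the collapse. -/

section NC
variable {g : ℕ}

theorem ncStar_add (p q : NCPoly g) : ncStar (p + q) = ncStar p + ncStar q :=
  MonoidAlgebra.mapDomain_add _ _ _

theorem ncStar_single (w : FreeMonoid (Fin g ⊕ Fin g)) (r : ℝ) :
    ncStar (MonoidAlgebra.single w r) = MonoidAlgebra.single (wordStar w) r :=
  MonoidAlgebra.mapDomain_single

theorem ncStar_smul (c : ℝ) (p : NCPoly g) : ncStar (c • p) = c • ncStar p := by
  induction p using MonoidAlgebra.induction_linear with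
  | zero => simp [ncStar]
  | add p q hp hq => rw [smul_add, ncStar_add, hp, hq, ncStar_add, smul_add]
  | single w r => simp [ncStar_single, MonoidAlgebra.smul_single]

/-- The involution as a linear map. -/
noncomputable def ncStarₗ (g : ℕ) : NCPoly g →ₗ[ℝ] NCPoly g where
  toFun := ncStar
  map_add' := ncStar_add
  map_smul' := ncStar_smul

theorem collapse_single (w : FreeMonoid (Fin g ⊕ Fin g)) (r : ℝ) :
    collapse (MonoidAlgebra.single w r) =
      r • FreeMonoid.lift (Sum.elim MvPolynomial.X MvPolynomial.X) w := by
  rw [collapse, MonoidAlgebra.lift_single]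

theorem collapse_ncStar (p : NCPoly g) : collapse (ncStar p) = collapse p := by
  induction p using MonoidAlgebra.induction_linear with
  | zero => simp [ncStar]
  | add p q hp hq => rw [ncStar_add, map_add, map_add, hp, hq]
  | single w r =>
    rw [ncStar_single, collapse_single, collapse_single]
    congr 1
    induction w using FreeMonoid.inductionOn' with
    | one => rfl
    | of_mul x w ih =>
      have h : wordStar (FreeMonoid.of x * w) = wordStar w * FreeMonoid.of x.swap := by
        simp [wordStar, FreeMonoid.reverse_mul]
      rw [h, map_mul, map_mul, ih, mul_comm]
      congr 1
      cases x <;> simp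

/-- The affine noncommutative polynomial `c + ∑ aᵢ xᵢ + ∑ bᵢ xᵢ*`. -/
noncomputable def ncAff (g : ℕ) : ℝ × (Fin g → ℝ) × (Fin g → ℝ) →ₗ[ℝ] NCPoly g where
  toFun z := MonoidAlgebra.single 1 z.1 +
    ((∑ i, MonoidAlgebra.single (FreeMonoid.of (Sum.inl i)) (z.2.1 i)) +
      ∑ i, MonoidAlgebra.single (FreeMonoid.of (Sum.inr i)) (z.2.2 i))
  map_add' z w := by
    simp only [Prod.fst_add, Prod.snd_add, Pi.add_apply, MonoidAlgebra.single_add,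
      Finset.sum_add_distrib]
    abel
  map_smul' c z := by
    simp [MonoidAlgebra.smul_single, smul_add, Finset.smul_sum]

theorem ncAff_apply (c : ℝ) (a b : Fin g → ℝ) :
    ncAff g (c, a, b) = MonoidAlgebra.single 1 c +
      ((∑ i, MonoidAlgebra.single (FreeMonoid.of (Sum.inl i)) (a i)) +
        ∑ i, MonoidAlgebra.single (FreeMonoid.of (Sum.inr i)) (b i)) := rfl

theorem mem_range_ncAff {p : NCPoly g} (hp : ∀ w ∈ p.coeff.support, FreeMonoid.length w ≤ 1) :
    p ∈ LinearMap.range (ncAff g) := by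
  have hsum : p = ∑ w ∈ p.coeff.support, MonoidAlgebra.single w (p.coeff w) := by
    have h := Finsupp.sum_single p.coeff
    apply MonoidAlgebra.coeff_injective
    conv_lhs => rw [← h]
    simp [Finsupp.sum, MonoidAlgebra.coeff_sum]
  rw [hsum]
  refine Submodule.sum_mem _ fun w hw => ?_
  generalize p.coeff w = r
  have hl := hp w hw
  rcases Nat.le_one_iff_eq_zero_or_eq_one.1 hl with h | h
  · rw [FreeMonoid.length_eq_zero] at h
    exact ⟨(r, 0, 0), by simp [ncAff_apply, h]⟩
  · rw [FreeMonoid.length_eq_one] at h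
    obtain ⟨x, rfl⟩ := h
    cases x with
    | inl i =>
      refine ⟨(0, Pi.single i r, 0), ?_⟩
      rw [ncAff_apply, Finset.sum_eq_single i] <;> simp +contextual
    | inr i =>
      refine ⟨(0, 0, Pi.single i r), ?_⟩
      rw [ncAff_apply, Finset.sum_eq_single_of_mem i (Finset.mem_univ i)
        (f := fun j => MonoidAlgebra.single (FreeMonoid.of (Sum.inr j)) (Pi.single i r j))] <;>
        simp +contextual

theorem ncStar_ncAff (c : ℝ) (a b : Fin g → ℝ) : ncStar (ncAff g (c, a, b)) = ncAff g (c, b, a) := by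
  change ncStarₗ g _ = _
  have h : ∀ w r, ncStarₗ g (MonoidAlgebra.single w r) = MonoidAlgebra.single (wordStar w) r :=
    ncStar_single
  simp only [ncAff_apply, map_add, map_sum, h]
  rw [add_comm (∑ i, MonoidAlgebra.single (FreeMonoid.of (Sum.inl i)) (b i))]
  rfl

/-- The affine polynomial `c + ∑ dᵢ xᵢ`. -/
noncomputable def mvAff {g : ℕ} (c : ℝ) (d : Fin g → ℝ) : MvPolynomial (Fin g) ℝ :=
  MvPolynomial.C c + ∑ i, MvPolynomial.C (d i) * MvPolynomial.X i

theorem totalDegree_mvAff_le (c : ℝ) (d : Fin g → ℝ) : (mvAff c d).totalDegree ≤ 1 := by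
  refine (MvPolynomial.totalDegree_add _ _).trans (max_le (by simp) ?_)
  refine MvPolynomial.totalDegree_finsetSum_le fun i _ => ?_
  refine (MvPolynomial.totalDegree_mul _ _).trans ?_
  simp

theorem eval_mvAff (c : ℝ) (d x : Fin g → ℝ) :
    MvPolynomial.eval x (mvAff c d) = c + ∑ i, d i * x i := by
  simp [mvAff]

theorem eq_mvAff_of_totalDegree_le_one {p : MvPolynomial (Fin g) ℝ} (hp : p.totalDegree ≤ 1) :
    ∃ c d, p = mvAff c d := by
  have hmem : p ∈ Submodule.span ℝ (insert 1 (Set.range (MvPolynomial.X (R := ℝ) (σ := Fin g)))) := by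
    rw [MvPolynomial.as_sum p]
    refine Submodule.sum_mem _ fun m hm => ?_
    have h : m.degree ≤ 1 := (MvPolynomial.le_totalDegree hm).trans hp
    rw [← mul_one (p.coeff m), ← smul_eq_mul, ← MvPolynomial.smul_monomial]
    refine Submodule.smul_mem _ _ (Submodule.subset_span ?_)
    rcases Nat.le_one_iff_eq_zero_or_eq_one.1 h with h | h
    · left
      rw [Finsupp.degree_eq_zero_iff] at h
      rw [h]; rfl
    · right
      have hne : m ≠ 0 := by
        rintro rfl
        simp at h
      obtain ⟨i, hi⟩ := Finsupp.ne_iff.1 hne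
      have hle : Finsupp.single i 1 ≤ m := by
        rw [Finsupp.single_le_iff]
        exact Nat.one_le_iff_ne_zero.2 hi
      obtain ⟨m', rfl⟩ := exists_add_of_le hle
      rw [map_add, Finsupp.degree_single] at h
      have h' : m' = 0 := (Finsupp.degree_eq_zero_iff m').1 (by omega)
      exact ⟨i, by simp [h', MvPolynomial.X]⟩
  clear hp
  induction hmem using Submodule.span_induction with
  | mem x hx =>
    rcases hx with rfl | ⟨i, rfl⟩
    · exact ⟨1, 0, by simp [mvAff]⟩
    · refine ⟨0, Pi.single i 1, ?_⟩
      rw [mvAff, Finset.sum_eq_single i] <;> simp +contextual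
  | zero => exact ⟨0, 0, by simp [mvAff]⟩
  | add x y _ _ hx hy =>
    obtain ⟨c, d, rfl⟩ := hx
    obtain ⟨c', d', rfl⟩ := hy
    refine ⟨c + c', d + d', ?_⟩
    simp only [mvAff, map_add, Pi.add_apply, add_mul, Finset.sum_add_distrib]
    ring
  | smul a x _ hx =>
    obtain ⟨c, d, rfl⟩ := hx
    refine ⟨a * c, a • d, ?_⟩
    simp [mvAff, MvPolynomial.smul_eq_C_mul, Finset.mul_sum, mul_assoc]

theorem mvAff_eq_zero {c : ℝ} {d : Fin g → ℝ} (h : mvAff c d = 0) : c = 0 ∧ d = 0 := by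
  have h0 : ∀ x : Fin g → ℝ, c + ∑ i, d i * x i = 0 := fun x => by
    rw [← eval_mvAff, h, map_zero]
  have hc : c = 0 := by simpa using h0 0
  refine ⟨hc, funext fun i => ?_⟩
  simpa [hc, Pi.single_apply] using h0 (Pi.single i 1)

theorem collapse_ncAff (c : ℝ) (a b : Fin g → ℝ) :
    collapse (ncAff g (c, a, b)) = mvAff c (a + b) := by
  simp only [ncAff_apply, map_add, map_sum, collapse_single, mvAff, Pi.add_apply]
  simp [add_mul, Finset.sum_add_distrib, MvPolynomial.smul_eq_C_mul]

/-- Symmetry equates the coefficients of `xᵢ` and `xᵢ*`, so the collapse loses no information on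
symmetric affine polynomials. -/
theorem eq_zero_of_symm_of_collapse_eq_zero {p : NCPoly g} (hp : p ∈ LinearMap.range (ncAff g))
    (hs : ncStar p = p) (hc : collapse p = 0) : p = 0 := by
  obtain ⟨⟨c, a, b⟩, rfl⟩ := hp
  rw [collapse_ncAff] at hc
  obtain ⟨hc, hab⟩ := mvAff_eq_zero hc
  rw [ncStar_ncAff] at hs
  have h : (2 : ℝ) • ncAff g (c, a, b) = 0 := by
    rw [two_smul]
    nth_rewrite 1 [← hs]
    rw [← map_add]
    have h0 : ((c, b, a) + (c, a, b) : ℝ × (Fin g → ℝ) × (Fin g → ℝ)) = 0 := by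
      simp [hc, hab, add_comm b a]
    rw [h0, map_zero]
  simpa using h

end NC

/-! ### Zero sets of affine polynomials and projections onto them. -/

section Affine
variable {g : ℕ}

theorem eval_add_add {f : MvPolynomial (Fin g) ℝ} (hf : f.totalDegree ≤ 1) (x v w : Fin g → ℝ) :
    MvPolynomial.eval (x + v + w) f =
      MvPolynomial.eval (x + v) f + MvPolynomial.eval (x + w) f - MvPolynomial.eval x f := by
  obtain ⟨c, d, rfl⟩ := eq_mvAff_of_totalDegree_le_one hf
  simp only [eval_mvAff, Pi.add_apply, mul_add, Finset.sum_add_distrib]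
  ring

theorem eval_add_smul {f : MvPolynomial (Fin g) ℝ} (hf : f.totalDegree ≤ 1) (x v : Fin g → ℝ)
    (a : ℝ) : MvPolynomial.eval (x + a • v) f =
      MvPolynomial.eval x f + a * (MvPolynomial.eval (x + v) f - MvPolynomial.eval x f) := by
  obtain ⟨c, d, rfl⟩ := eq_mvAff_of_totalDegree_le_one hf
  simp only [eval_mvAff, Pi.add_apply, mul_add, Finset.sum_add_distrib, Pi.smul_apply, smul_eq_mul]
  have h : ∑ i, d i * (a * v i) = a * ∑ i, d i * v i := by
    rw [Finset.mul_sum]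
    exact Finset.sum_congr rfl fun i _ => by ring
  rw [h]
  ring

/-- The common zeros of a space of polynomials. -/
def commonZeros (U : Submodule ℝ (MvPolynomial (Fin g) ℝ)) : Set (Fin g → ℝ) :=
  {x | ∀ u ∈ U, MvPolynomial.eval x u = 0}

theorem linearMap_mvAff (φ : MvPolynomial (Fin g) ℝ →ₗ[ℝ] ℝ) (c : ℝ) (d : Fin g → ℝ) :
    φ (mvAff c d) = c * φ 1 + ∑ i, d i * φ (MvPolynomial.X i) := by
  have h : mvAff c d = c • (1 : MvPolynomial (Fin g) ℝ) + ∑ i, d i • MvPolynomial.X i := by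
    simp [mvAff, MvPolynomial.smul_eq_C_mul]
  rw [h]
  simp

/-- A functional not vanishing at `1` is, on affine polynomials, a multiple of a point evaluation. -/
theorem linearMap_eq_mul_eval {φ : MvPolynomial (Fin g) ℝ →ₗ[ℝ] ℝ} (h1 : φ 1 ≠ 0)
    {f : MvPolynomial (Fin g) ℝ} (hf : f.totalDegree ≤ 1) :
    φ f = φ 1 * MvPolynomial.eval (fun i => φ (MvPolynomial.X i) / φ 1) f := by
  obtain ⟨c, d, rfl⟩ := eq_mvAff_of_totalDegree_le_one hf
  rw [linearMap_mvAff, eval_mvAff, mul_add, Finset.mul_sum, mul_comm c]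
  congr 1
  refine Finset.sum_congr rfl fun i _ => ?_
  field_simp

/-- A functional that kills `U` but not `1` is, up to scale, evaluation at a common zero. -/
theorem one_mem_of_commonZeros_eq_empty {U : Submodule ℝ (MvPolynomial (Fin g) ℝ)}
    (hU : ∀ u ∈ U, u.totalDegree ≤ 1) (h : commonZeros U = ∅) : 1 ∈ U := by
  by_contra h1
  obtain ⟨φ, hφ, hle⟩ := Submodule.exists_le_ker_of_notMem h1
  have hx : (fun i => φ (MvPolynomial.X i) / φ 1) ∈ commonZeros U := by
    intro u hu
    have h2 : φ u = 0 := hle hu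
    rw [linearMap_eq_mul_eval hφ (hU u hu)] at h2
    exact (mul_eq_zero.1 h2).resolve_left hφ
  rw [h] at hx
  exact hx

/-- A linear Nullstellensatz by duality: a functional killing `U` but not `f` yields a common zero
at which `f` does not vanish. -/
theorem mem_of_eval_eq_zero_on_commonZeros {U : Submodule ℝ (MvPolynomial (Fin g) ℝ)}
    (hU : ∀ u ∈ U, u.totalDegree ≤ 1) (hne : (commonZeros U).Nonempty)
    {f : MvPolynomial (Fin g) ℝ} (hf : f.totalDegree ≤ 1)
    (hz : ∀ x ∈ commonZeros U, MvPolynomial.eval x f = 0) : f ∈ U := by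
  by_contra hfU
  obtain ⟨φ, hφ, hle⟩ := Submodule.exists_le_ker_of_notMem hfU
  by_cases h1 : φ 1 = 0
  -- Here `φ` is a point at infinity: its values on the variables form a direction of the zero set,
  -- along which `f` changes.
  · obtain ⟨z, hzU⟩ := hne
    have key : ∀ h : MvPolynomial (Fin g) ℝ, h.totalDegree ≤ 1 →
        MvPolynomial.eval (z + fun i => φ (MvPolynomial.X i)) h = MvPolynomial.eval z h + φ h := by
      intro h hh
      obtain ⟨c, d, rfl⟩ := eq_mvAff_of_totalDegree_le_one hh
      simp only [eval_mvAff, linearMap_mvAff, h1, Pi.add_apply, mul_add, Finset.sum_add_distrib]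
      ring
    have hz' : (z + fun i => φ (MvPolynomial.X i)) ∈ commonZeros U := by
      intro u hu
      rw [key u (hU u hu), hzU u hu, zero_add]
      exact hle hu
    have h2 := hz _ hz'
    rw [key f hf, hz z hzU, zero_add] at h2
    exact hφ h2
  · have hx : (fun i => φ (MvPolynomial.X i) / φ 1) ∈ commonZeros U := by
      intro u hu
      have h2 : φ u = 0 := hle hu
      rw [linearMap_eq_mul_eval h1 (hU u hu)] at h2
      exact (mul_eq_zero.1 h2).resolve_left h1
    rw [linearMap_eq_mul_eval h1 hf, hz _ hx, mul_zero] at hφ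
    exact hφ rfl

theorem add_smul_sub_mem_commonZeros {U : Submodule ℝ (MvPolynomial (Fin g) ℝ)}
    (hU : ∀ u ∈ U, u.totalDegree ≤ 1) {x y : Fin g → ℝ} (hx : x ∈ commonZeros U)
    (hy : y ∈ commonZeros U) (a : ℝ) : x + a • (y - x) ∈ commonZeros U := by
  intro u hu
  rw [eval_add_smul (hU u hu), add_sub_cancel, hx u hu, hy u hu]
  simp

/-- An affine polynomial bounded above on an affine subspace is constant there. -/
theorem eval_eq_of_bddAbove_on_commonZeros {U : Submodule ℝ (MvPolynomial (Fin g) ℝ)}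
    (hU : ∀ u ∈ U, u.totalDegree ≤ 1) {f : MvPolynomial (Fin g) ℝ} (hf : f.totalDegree ≤ 1)
    {M : ℝ} (hM : ∀ x ∈ commonZeros U, MvPolynomial.eval x f ≤ M) {x y : Fin g → ℝ}
    (hx : x ∈ commonZeros U) (hy : y ∈ commonZeros U) :
    MvPolynomial.eval y f = MvPolynomial.eval x f := by
  by_contra h
  set δ := MvPolynomial.eval y f - MvPolynomial.eval x f with hδ
  have hδ0 : δ ≠ 0 := sub_ne_zero.2 h
  -- On the line through `x` and `y` this parameter gives `f` the value `M + 1`.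
  have h1 := hM _ (add_smul_sub_mem_commonZeros hU hx hy ((M + 1 - MvPolynomial.eval x f) / δ))
  rw [eval_add_smul hf, add_sub_cancel, ← hδ, div_mul_cancel₀ _ hδ0] at h1
  linarith

/-- An affine subspace is the image of a polynomial affine projection. -/
theorem exists_affine_projection {U : Submodule ℝ (MvPolynomial (Fin g) ℝ)}
    (hU : ∀ u ∈ U, u.totalDegree ≤ 1) (hne : (commonZeros U).Nonempty) :
    ∃ π : Fin g → MvPolynomial (Fin g) ℝ, (∀ i, (π i).totalDegree ≤ 1) ∧
      (∀ x, (fun i => MvPolynomial.eval x (π i)) ∈ commonZeros U) ∧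
      ∀ x ∈ commonZeros U, (fun i => MvPolynomial.eval x (π i)) = x := by
  obtain ⟨z, hz⟩ := hne
  -- The direction space at the base point `z`; the projection is `x ↦ z + P (x - z)`.
  let K : Submodule ℝ (Fin g → ℝ) :=
    { carrier := {v | z + v ∈ commonZeros U}
      zero_mem' := by simpa using hz
      add_mem' := fun {v w} hv hw u hu => by
        rw [← add_assoc, eval_add_add (hU u hu), hv u hu, hw u hu, hz u hu]
        simp
      smul_mem' := fun a v hv u hu => by
        rw [eval_add_smul (hU u hu), hv u hu, hz u hu]
        simp }
  obtain ⟨P, -, hPK, hPid⟩ := exists_orthogonal_projection_matrix K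
  have hev : ∀ x, (fun i => MvPolynomial.eval x (mvAff (z i - P.mulVec z i) (P i))) =
      z + P.mulVec (x - z) := by
    intro x
    ext i
    rw [eval_mvAff, Pi.add_apply, Matrix.mulVec_sub, Pi.sub_apply]
    simp only [Matrix.mulVec, dotProduct]
    ring
  refine ⟨fun i => mvAff (z i - P.mulVec z i) (P i), fun i => totalDegree_mvAff_le _ _,
    fun x => ?_, fun x hx => ?_⟩
  · rw [hev]
    exact hPK (x - z)
  · rw [hev, hPid (x - z) (by change z + (x - z) ∈ commonZeros U; rwa [add_sub_cancel]), add_sub_cancel]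

theorem eval_bind₁ (π : Fin g → MvPolynomial (Fin g) ℝ) (x : Fin g → ℝ)
    (p : MvPolynomial (Fin g) ℝ) :
    MvPolynomial.eval x (MvPolynomial.bind₁ π p) =
      MvPolynomial.eval (fun i => MvPolynomial.eval x (π i)) p := by
  induction p using MvPolynomial.induction_on with
  | C a => simp
  | add p q hp hq => simp [hp, hq]
  | mul_X p i hp => simp [hp]

theorem totalDegree_bind₁_le_one {π : Fin g → MvPolynomial (Fin g) ℝ}
    (hπ : ∀ i, (π i).totalDegree ≤ 1) {p : MvPolynomial (Fin g) ℝ} (hp : p.totalDegree ≤ 1) :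
    (MvPolynomial.bind₁ π p).totalDegree ≤ 1 := by
  obtain ⟨c, d, rfl⟩ := eq_mvAff_of_totalDegree_le_one hp
  simp only [mvAff, map_add, map_sum, map_mul, MvPolynomial.bind₁_C_right,
    MvPolynomial.bind₁_X_right]
  refine (MvPolynomial.totalDegree_add _ _).trans (max_le (by simp) ?_)
  refine MvPolynomial.totalDegree_finsetSum_le fun i _ => ?_
  refine (MvPolynomial.totalDegree_mul _ _).trans ?_
  simpa using hπ i

theorem sub_bind₁_mem {π : Fin g → MvPolynomial (Fin g) ℝ} {I : Ideal (MvPolynomial (Fin g) ℝ)}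
    (h : ∀ i, MvPolynomial.X i - π i ∈ I) (p : MvPolynomial (Fin g) ℝ) :
    p - MvPolynomial.bind₁ π p ∈ I := by
  induction p using MvPolynomial.induction_on with
  | C a => simp
  | add p q hp hq =>
    rw [map_add, add_sub_add_comm]
    exact I.add_mem hp hq
  | mul_X p i hp =>
    rw [map_mul, MvPolynomial.bind₁_X_right]
    have h2 := I.add_mem (I.mul_mem_right (MvPolynomial.X i) hp)
      (I.mul_mem_left (MvPolynomial.bind₁ π p) (h i))
    convert h2 using 1
    ring

/-- A real polynomial vanishing on a nonempty open set is zero. -/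
theorem eq_zero_of_eval_eq_zero_on_open {p : MvPolynomial (Fin g) ℝ} {O : Set (Fin g → ℝ)}
    (hO : IsOpen O) (hne : O.Nonempty) (h : ∀ x ∈ O, MvPolynomial.eval x p = 0) : p = 0 := by
  obtain ⟨x, hx⟩ := hne
  obtain ⟨ε, hε, hball⟩ := Metric.isOpen_iff.1 hO x hx
  refine MvPolynomial.funext_set (fun i => Metric.ball (x i) ε) (fun i => ?_) fun y hy => ?_
  · rw [Real.ball_eq_Ioo]
    exact Set.Ioo_infinite (by linarith)
  · rw [map_zero]
    exact h y (hball (by rwa [ball_pi x hε]))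

end Affine

/-! ### Real left ideals and their affine elements. -/

section LReal
variable {g ν : ℕ}

theorem isLReal_lRealRadical (L : Matrix (Fin ν) (Fin ν) (NCPoly g)) (I : Ideal (NCPoly g)) :
    IsLReal L (lRealRadical L I) := by
  rintro m k p q ⟨a, ha, b, hb, h⟩
  have hJ : ∀ J ∈ {J : Ideal (NCPoly g) | I ≤ J ∧ IsLReal L J},
      (∀ i, p i ∈ J) ∧ ∀ j s, L.mulVec (q j) s ∈ J := fun J hJ =>
    hJ.2 m k p q ⟨a, (Submodule.mem_sInf.1 ha) J hJ, b, (Submodule.mem_sInf.1 hb) J hJ, h⟩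
  exact ⟨fun i => Submodule.mem_sInf.2 fun J h => (hJ J h).1 i,
    fun j s => Submodule.mem_sInf.2 fun J h => (hJ J h).2 j s⟩

/-- Evaluation of a noncommutative polynomial at a real point. -/
noncomputable def evalCollapse (x : Fin g → ℝ) : NCPoly g →+* ℝ :=
  (MvPolynomial.eval x).comp (collapse (g := g)).toRingHom

theorem evalCollapse_apply (x : Fin g → ℝ) (p : NCPoly g) :
    evalCollapse x p = MvPolynomial.eval x (collapse p) := rfl

theorem evalCollapse_ncStar (x : Fin g → ℝ) (p : NCPoly g) :
    evalCollapse x (ncStar p) = evalCollapse x p := by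
  rw [evalCollapse_apply, collapse_ncStar, evalCollapse_apply]

/-- Evaluation turns the certificate into a vanishing sum of nonnegative terms, so each is zero; for
`M ⪰ 0`, `vᵀ M v = 0` implies `M v = 0`. -/
theorem isLReal_ker_evalCollapse {L₀ : Matrix (Fin ν) (Fin ν) (NCPoly g)} {x : Fin g → ℝ}
    (hx : x ∈ spectrahedron (L₀.map collapse)) : IsLReal L₀ (RingHom.ker (evalCollapse x)) := by
  rintro m k p q ⟨a, ha, b, hb, h⟩
  have hpsd : ((L₀.map collapse).map (MvPolynomial.eval x)).PosSemidef := hx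
  set M := (L₀.map collapse).map (MvPolynomial.eval x) with hM
  have hM' : ∀ s t, evalCollapse x (L₀ s t) = M s t := fun s t => rfl
  have h1 := congrArg (evalCollapse x) h
  rw [map_add, map_add, evalCollapse_ncStar, RingHom.mem_ker.1 ha, RingHom.mem_ker.1 hb] at h1
  simp only [map_sum, map_mul, evalCollapse_ncStar, hM', add_zero] at h1
  set v : Fin k → Fin ν → ℝ := fun j s => evalCollapse x (q j s) with hv
  have hq : ∀ j, ∑ s, ∑ t, evalCollapse x (q j s) * M s t * evalCollapse x (q j t) =
      dotProduct (star (v j)) (M.mulVec (v j)) := by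
    intro j
    simp only [star_trivial, dotProduct, Matrix.mulVec, Finset.mul_sum, hv, mul_assoc]
  simp only [hq] at h1
  have hp0 : 0 ≤ ∑ i, evalCollapse x (p i) * evalCollapse x (p i) :=
    Finset.sum_nonneg fun i _ => mul_self_nonneg _
  have hq0 : ∀ j, 0 ≤ dotProduct (star (v j)) (M.mulVec (v j)) := fun j =>
    hpsd.dotProduct_mulVec_nonneg (v j)
  have hq1 : 0 ≤ ∑ j, dotProduct (star (v j)) (M.mulVec (v j)) :=
    Finset.sum_nonneg fun j _ => hq0 j
  have hp2 : ∑ i, evalCollapse x (p i) * evalCollapse x (p i) = 0 := by linarith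
  have hq2 : ∑ j, dotProduct (star (v j)) (M.mulVec (v j)) = 0 := by linarith
  rw [Finset.sum_eq_zero_iff_of_nonneg fun i _ => mul_self_nonneg _] at hp2
  rw [Finset.sum_eq_zero_iff_of_nonneg fun j _ => hq0 j] at hq2
  refine ⟨fun i => RingHom.mem_ker.2 (mul_self_eq_zero.1 (hp2 i (Finset.mem_univ i))),
    fun j s => RingHom.mem_ker.2 ?_⟩
  have h3 := congrFun ((hpsd.dotProduct_mulVec_zero_iff (v j)).1 (hq2 j (Finset.mem_univ j))) s
  simpa [Matrix.mulVec, dotProduct, hv, hM'] using h3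

theorem eval_collapse_eq_zero_of_mem_lRealRadical {L₀ : Matrix (Fin ν) (Fin ν) (NCPoly g)}
    {x : Fin g → ℝ} (hx : x ∈ spectrahedron (L₀.map collapse)) {r : NCPoly g}
    (hr : r ∈ lRealRadical L₀ ⊥) : MvPolynomial.eval x (collapse r) = 0 :=
  RingHom.mem_ker.1 ((Submodule.mem_sInf.1 hr) _ ⟨bot_le, isLReal_ker_evalCollapse hx⟩)

/-- The collapses of the affine elements of a left ideal. -/
noncomputable def affineCollapse (R : Ideal (NCPoly g)) :
    Submodule ℝ (MvPolynomial (Fin g) ℝ) :=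
  (R.restrictScalars ℝ ⊓ LinearMap.range (ncAff g)).map (collapse (g := g)).toLinearMap

theorem mem_affineCollapse {R : Ideal (NCPoly g)} {f : MvPolynomial (Fin g) ℝ} :
    f ∈ affineCollapse R ↔ ∃ r ∈ R, r ∈ LinearMap.range (ncAff g) ∧ collapse r = f := by
  simp only [affineCollapse, Submodule.mem_map, Submodule.mem_inf, and_assoc]
  rfl

theorem totalDegree_le_of_mem_affineCollapse {R : Ideal (NCPoly g)}
    {f : MvPolynomial (Fin g) ℝ} (hf : f ∈ affineCollapse R) : f.totalDegree ≤ 1 := by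
  obtain ⟨r, -, ⟨⟨c, a, b⟩, rfl⟩, rfl⟩ := mem_affineCollapse.1 hf
  rw [collapse_ncAff]
  exact totalDegree_mvAff_le _ _

theorem algebraMap_mem_range_ncAff (c : ℝ) :
    algebraMap ℝ (NCPoly g) c ∈ LinearMap.range (ncAff g) :=
  ⟨(c, 0, 0), by simp [ncAff_apply]⟩

theorem ncStar_algebraMap (c : ℝ) :
    ncStar (algebraMap ℝ (NCPoly g) c) = algebraMap ℝ (NCPoly g) c :=
  ncStar_single 1 c

theorem one_mem_affineCollapse {R : Ideal (NCPoly g)} (h : (1 : NCPoly g) ∈ R) :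
    1 ∈ affineCollapse R :=
  mem_affineCollapse.2 ⟨1, h, by
    rw [← map_one (algebraMap ℝ (NCPoly g))]
    exact algebraMap_mem_range_ncAff 1, map_one _⟩

theorem ncStar_mem_range_ncAff {p : NCPoly g} (hp : p ∈ LinearMap.range (ncAff g)) :
    ncStar p ∈ LinearMap.range (ncAff g) := by
  obtain ⟨⟨c, a, b⟩, rfl⟩ := hp
  exact ⟨_, (ncStar_ncAff c a b).symm⟩

/-- A symmetric affine polynomial whose collapse comes from an affine element of `R` lies
in `R + R*`. -/
theorem exists_eq_add_ncStar {R : Ideal (NCPoly g)} {p : NCPoly g}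
    (hp : p ∈ LinearMap.range (ncAff g)) (hs : ncStar p = p)
    (hc : collapse p ∈ affineCollapse R) : ∃ a ∈ R, ∃ b ∈ R, p = a + ncStar b := by
  obtain ⟨r, hr, hra, hrc⟩ := mem_affineCollapse.1 hc
  have hmem : (1 / 2 : ℝ) • r ∈ R := (R.restrictScalars ℝ).smul_mem _ hr
  -- The claim is `p = r/2 + (r/2)*`: both sides are symmetric and affine with the same collapse.
  refine ⟨_, hmem, _, hmem, ?_⟩
  have hstar : ∀ q : NCPoly g, ncStar (ncStar q) = q → ncStar (p - ((1 / 2 : ℝ) • r + ncStar q)) =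
      p - (ncStar ((1 / 2 : ℝ) • r) + q) := by
    intro q hq
    change ncStarₗ g _ = _
    rw [map_sub, map_add]
    change ncStar p - (_ + ncStar (ncStar q)) = _
    rw [hs, hq]
    rfl
  have hinv : ncStar (ncStar r) = r := by
    obtain ⟨⟨c, a, b⟩, rfl⟩ := hra
    rw [ncStar_ncAff, ncStar_ncAff]
  rw [← sub_eq_zero]
  refine eq_zero_of_symm_of_collapse_eq_zero ?_ ?_ ?_
  · rw [ncStar_smul]
    exact Submodule.sub_mem _ hp (Submodule.add_mem _ (Submodule.smul_mem _ _ hra)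
      (Submodule.smul_mem _ _ (ncStar_mem_range_ncAff hra)))
  · rw [hstar _ (by rw [ncStar_smul, ncStar_smul, hinv]), add_comm]
  · rw [map_sub, map_add, collapse_ncStar, map_smul, hrc, ← add_smul]
    norm_num

/-- Transfers realness to the commutative side for constant columns: the symmetric lift of the given
sum lies in `R + R*`, and `c` is the square of the constant `√c`. -/
theorem IsLReal.of_const_mem_affineCollapse {L₀ : Matrix (Fin ν) (Fin ν) (NCPoly g)}
    (hL₀ : IsNCLinearPencil L₀) {R : Ideal (NCPoly g)} (hR : IsLReal L₀ R)
    (h1 : (1 : MvPolynomial (Fin g) ℝ) ∉ affineCollapse R) {k : ℕ} (B : Fin k → Fin ν → ℝ) {c : ℝ}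
    (hc : 0 ≤ c)
    (h : (∑ j, ∑ s, ∑ t, (B j s * B j t) • collapse (L₀ s t)) + MvPolynomial.C c ∈
      affineCollapse R) :
    c = 0 ∧ ∀ j s, ∑ t, B j t • collapse (L₀ s t) ∈ affineCollapse R := by
  have hdeg : ∀ s t, L₀ s t ∈ LinearMap.range (ncAff g) := fun s t =>
    mem_range_ncAff (hL₀.2 s t)
  have hsymm : ∀ s t, ncStar (L₀ s t) = L₀ t s := fun s t =>
    congrFun (congrFun hL₀.1 t) s
  set p : NCPoly g := algebraMap ℝ _ c + ∑ j, ∑ s, ∑ t, (B j s * B j t) • L₀ s t with hp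
  have hpm : p ∈ LinearMap.range (ncAff g) :=
    Submodule.add_mem _ (algebraMap_mem_range_ncAff c) <| Submodule.sum_mem _ fun j _ =>
      Submodule.sum_mem _ fun s _ => Submodule.sum_mem _ fun t _ =>
        Submodule.smul_mem _ _ (hdeg s t)
  have hps : ncStar p = p := by
    have hl : ncStar p = ncStar (algebraMap ℝ _ c) +
        ∑ j, ∑ s, ∑ t, (B j s * B j t) • ncStar (L₀ s t) := by
      change ncStarₗ g p = _
      rw [hp]
      simp only [map_add, map_sum, map_smul]
      rfl
    rw [hl, ncStar_algebraMap, hp]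
    congr 1
    refine Finset.sum_congr rfl fun j _ => ?_
    rw [Finset.sum_comm]
    refine Finset.sum_congr rfl fun s _ => Finset.sum_congr rfl fun t _ => ?_
    rw [hsymm, mul_comm]
  have hpc : collapse p ∈ affineCollapse R := by
    rw [hp, map_add, add_comm]
    simp only [map_sum, map_smul, AlgHom.commutes]
    exact h
  obtain ⟨a, ha, b, hb, hab⟩ := exists_eq_add_ncStar hpm hps hpc
  obtain ⟨hsq, hLq⟩ := hR 1 k (fun _ => algebraMap ℝ _ (√c))
    (fun j s => algebraMap ℝ _ (B j s)) ⟨a, ha, b, hb, by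
      rw [← hab, hp]
      congr 1
      · simp only [ncStar_algebraMap, Finset.univ_unique, Finset.sum_singleton, ← map_mul]
        rw [Real.mul_self_sqrt hc]
      · refine Finset.sum_congr rfl fun j _ => Finset.sum_congr rfl fun s _ =>
          Finset.sum_congr rfl fun t _ => ?_
        rw [ncStar_algebraMap, ← Algebra.commutes, ← mul_assoc, ← map_mul, Algebra.smul_def,
          mul_comm (B j t)]⟩
  constructor
  · by_contra hc0
    have hs : √c ≠ 0 := (Real.sqrt_pos.2 (lt_of_le_of_ne hc (Ne.symm hc0))).ne'
    apply h1
    apply one_mem_affineCollapse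
    have h2 := (R.restrictScalars ℝ).smul_mem (√c)⁻¹ (hsq 0)
    rw [Algebra.smul_def, ← map_mul, inv_mul_cancel₀ hs, map_one] at h2
    exact h2
  · intro j s
    have hmv : L₀.mulVec (fun t => algebraMap ℝ _ (B j t)) s = ∑ t, B j t • L₀ s t := by
      simp only [Matrix.mulVec, dotProduct]
      refine Finset.sum_congr rfl fun t _ => ?_
      rw [← Algebra.commutes, Algebra.smul_def]
    refine mem_affineCollapse.2 ⟨∑ t, B j t • L₀ s t, hmv ▸ hLq j s,
      Submodule.sum_mem _ fun t _ => Submodule.smul_mem _ _ (hdeg s t), ?_⟩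
    simp only [map_sum, map_smul]

end LReal

/-! ### Relative interior of the spectrahedron, and substitution into pencils. -/

section Spectrahedron
variable {g ν : ℕ}

open Matrix in
/-- The points of the zero set of `affineCollapse R` where the pencil is as positive as possible
form a nonempty relatively open set on which the pencil is positive semidefinite. -/
theorem IsLReal.exists_isOpen_inter_subset_spectrahedron
    {L₀ : Matrix (Fin ν) (Fin ν) (NCPoly g)} (hL₀ : IsNCLinearPencil L₀)
    (hL : IsLinearPencil (L₀.map collapse)) {R : Ideal (NCPoly g)} (hR : IsLReal L₀ R)
    (h1 : (1 : MvPolynomial (Fin g) ℝ) ∉ affineCollapse R) :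
    ∃ O : Set (Fin g → ℝ), IsOpen O ∧ (O ∩ commonZeros (affineCollapse R)).Nonempty ∧
      O ∩ commonZeros (affineCollapse R) ⊆ spectrahedron (L₀.map collapse) := by
  set U := affineCollapse R with hUdef
  have hU : ∀ u ∈ U, u.totalDegree ≤ 1 := fun u hu => totalDegree_le_of_mem_affineCollapse hu
  have hne : (commonZeros U).Nonempty := by
    by_contra h
    exact h1 (one_mem_of_commonZeros_eq_empty hU (Set.not_nonempty_iff_eq_empty.1 h))
  let M : (Fin g → ℝ) → Matrix (Fin ν) (Fin ν) ℝ := fun x =>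
    (L₀.map collapse).map (MvPolynomial.eval x)
  have hMapp : ∀ x s t, M x s t = MvPolynomial.eval x (collapse (L₀ s t)) := fun _ _ _ => rfl
  have hMT : ∀ x, (M x)ᵀ = M x := fun x => by
    change ((L₀.map collapse).map (MvPolynomial.eval x))ᵀ = _
    rw [← transpose_map, hL.1]
  have hMcont : Continuous M := by
    refine continuous_matrix fun s t => ?_
    exact MvPolynomial.continuous_eval _
  have hMaff : ∀ (x y : Fin g → ℝ) (a : ℝ), M (x + a • (y - x)) = M x + a • (M y - M x) := by
    intro x y a
    ext s t
    have h := eval_add_smul (hL.2 s t) x (y - x) a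
    rw [add_sub_cancel] at h
    simpa [hMapp] using h
  -- The common kernel obstructs definiteness of every `M x`; adding the projection onto it removes
  -- exactly this obstruction.
  let K : Submodule ℝ (Fin ν → ℝ) :=
    { carrier := {v | ∀ x ∈ commonZeros U, M x *ᵥ v = 0}
      zero_mem' := fun x _ => mulVec_zero _
      add_mem' := fun {v w} hv hw x hx => by rw [mulVec_add, hv x hx, hw x hx, add_zero]
      smul_mem' := fun a v hv x hx => by rw [mulVec_smul, hv x hx, smul_zero] }
  obtain ⟨P, hPT, hPK, hPid⟩ := exists_orthogonal_projection_matrix K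
  have hPnn : ∀ v, 0 ≤ v ⬝ᵥ P *ᵥ v := by
    intro v
    have h : v ⬝ᵥ P *ᵥ v = P *ᵥ v ⬝ᵥ P *ᵥ v := by
      rw [← hPid _ (hPK v), dotProduct_mulVec, ← mulVec_transpose, hPT, hPid _ (hPK v)]
    rw [h]
    simpa using dotProduct_self_star_nonneg (P *ᵥ v)
  have hex : ∃ x ∈ commonZeros U, M x + P ∈ posForms ν := by
    by_contra! hno
    obtain ⟨B, hB0, hB⟩ := exists_separating_gram
      (t := (fun x => M x + P) '' commonZeros U) (by
        rintro _ ⟨x, hx, rfl⟩ _ ⟨y, hy, rfl⟩ a b _ _ hab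
        refine ⟨x + b • (y - x), add_smul_sub_mem_commonZeros hU hx hy b, ?_⟩
        obtain rfl : a = 1 - b := by linarith
        simp only [hMaff]
        module) (hne.image _) (by
        rintro _ ⟨x, -, rfl⟩
        rw [transpose_add, hMT, hPT]) (by
        rw [Set.disjoint_right]
        rintro _ ⟨x, hx, rfl⟩
        exact hno x hx)
    set f : MvPolynomial (Fin g) ℝ :=
      ∑ j, ∑ s, ∑ t, (B j s * B j t) • collapse (L₀ s t) with hf
    have hfdeg : f.totalDegree ≤ 1 :=
      MvPolynomial.totalDegree_finsetSum_le fun j _ =>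
        MvPolynomial.totalDegree_finsetSum_le fun s _ =>
          MvPolynomial.totalDegree_finsetSum_le fun t _ =>
            (MvPolynomial.totalDegree_smul_le _ _).trans (hL.2 s t)
    have hfev : ∀ x, MvPolynomial.eval x f = ∑ j, B j ⬝ᵥ M x *ᵥ B j := by
      intro x
      simp only [hf, map_sum, MvPolynomial.smul_eval, dotProduct, mulVec, Finset.mul_sum, hMapp]
      refine Finset.sum_congr rfl fun j _ => Finset.sum_congr rfl fun s _ =>
        Finset.sum_congr rfl fun t _ => ?_
      ring
    have hPsum : 0 ≤ ∑ j, B j ⬝ᵥ P *ᵥ B j := Finset.sum_nonneg fun j _ => hPnn _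
    have hbd : ∀ x ∈ commonZeros U, MvPolynomial.eval x f ≤ -∑ j, B j ⬝ᵥ P *ᵥ B j := by
      intro x hx
      have h := hB _ ⟨x, hx, rfl⟩
      simp only [add_mulVec, dotProduct_add, Finset.sum_add_distrib] at h
      rw [hfev]
      linarith
    obtain ⟨z, hz⟩ := hne
    have hmem : f + MvPolynomial.C (-MvPolynomial.eval z f) ∈ U := by
      refine mem_of_eval_eq_zero_on_commonZeros hU ⟨z, hz⟩ ?_ fun x hx => ?_
      · exact (MvPolynomial.totalDegree_add _ _).trans (max_le hfdeg (by simp))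
      · rw [map_add, MvPolynomial.eval_C, eval_eq_of_bddAbove_on_commonZeros hU hfdeg hbd hz hx]
        ring
    obtain ⟨hc, hLB⟩ := hR.of_const_mem_affineCollapse hL₀ h1 B
      (by linarith [hbd z hz]) hmem
    have hBK : ∀ j, B j ∈ K := by
      intro j x hx
      ext s
      have h := hx _ (hLB j s)
      simp only [map_sum, MvPolynomial.smul_eval] at h
      rw [Pi.zero_apply, ← h]
      simp only [mulVec, dotProduct, hMapp]
      exact Finset.sum_congr rfl fun t _ => mul_comm _ _
    -- At `z` the value of `f` is zero by `hc`, and `P` fixes each `B j`.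
    have hsum : ∑ j, B j ⬝ᵥ B j ≤ 0 := by
      have h := hbd z hz
      simp only [fun j => hPid _ (hBK j)] at h
      linarith
    apply hB0
    have hnn : ∀ j, 0 ≤ B j ⬝ᵥ B j := fun j => by
      simpa using dotProduct_self_star_nonneg (B j)
    have h0 := (Finset.sum_eq_zero_iff_of_nonneg fun j _ => hnn j).1
      (le_antisymm hsum (Finset.sum_nonneg fun j _ => hnn j))
    ext j s
    exact congrFun (dotProduct_self_eq_zero.1 (h0 j (Finset.mem_univ j))) s
  obtain ⟨x₀, hx₀, hpos⟩ := hex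
  refine ⟨(fun x => M x + P) ⁻¹' posForms ν,
    (isOpen_posForms ν).preimage (hMcont.add continuous_const), ⟨x₀, hpos, hx₀⟩, ?_⟩
  rintro x ⟨hxp, hx⟩
  refine PosSemidef.of_dotProduct_mulVec_nonneg ?_ fun v => ?_
  · change (M x)ᴴ = M x
    rw [conjTranspose_eq_transpose_of_trivial, hMT]
  · change 0 ≤ star v ⬝ᵥ M x *ᵥ v
    rw [star_trivial]
    -- Both `M x` and its form ignore the `K`-component of `v`; on the remainder `w`, `P` vanishes
    -- and `M x + P` agrees with `M x`.
    set w := v - P *ᵥ v with hw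
    have hMP : M x *ᵥ (P *ᵥ v) = 0 := hPK v x hx
    have hMw : M x *ᵥ v = M x *ᵥ w := by rw [hw, mulVec_sub, hMP, sub_zero]
    have hPw : P *ᵥ w = 0 := by rw [hw, mulVec_sub, hPid _ (hPK v), sub_self]
    have hvw : v ⬝ᵥ M x *ᵥ w = w ⬝ᵥ (M x + P) *ᵥ w := by
      have h : (P *ᵥ v) ⬝ᵥ M x *ᵥ w = 0 := by
        rw [dotProduct_mulVec, ← mulVec_transpose, hMT, hMP, zero_dotProduct]
      rw [add_mulVec, hPw, add_zero]
      conv_rhs => rw [hw, sub_dotProduct, ← hw, h, sub_zero]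
    rw [hMw, hvw]
    by_cases hw0 : w = 0
    · simp [hw0]
    · exact (hxp w hw0).le

theorem collapse_surjective : Function.Surjective (collapse (g := g)) := by
  intro p
  induction p using MvPolynomial.induction_on with
  | C a => exact ⟨algebraMap ℝ _ a, collapse.commutes a⟩
  | add p q hp hq =>
    obtain ⟨a, rfl⟩ := hp
    obtain ⟨b, rfl⟩ := hq
    exact ⟨a + b, map_add _ _ _⟩
  | mul_X p i hp =>
    obtain ⟨a, rfl⟩ := hp
    exact ⟨a * MonoidAlgebra.single (FreeMonoid.of (Sum.inl i)) 1, by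
      rw [map_mul, collapse_single]; simp⟩

theorem mem_map_collapse {R : Ideal (NCPoly g)} {f : MvPolynomial (Fin g) ℝ} :
    f ∈ R.map collapse ↔ ∃ r ∈ R, collapse r = f :=
  Ideal.mem_map_iff_of_surjective _ collapse_surjective

theorem span_affineCollapse_le (R : Ideal (NCPoly g)) :
    Ideal.span (affineCollapse R : Set (MvPolynomial (Fin g) ℝ)) ≤ R.map collapse := by
  refine Ideal.span_le.2 fun f hf => ?_
  obtain ⟨r, hr, -, hrf⟩ := mem_affineCollapse.1 hf
  exact mem_map_collapse.2 ⟨r, hr, hrf⟩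

theorem spectrahedron_map_bind₁ (L : Matrix (Fin ν) (Fin ν) (MvPolynomial (Fin g) ℝ))
    (π : Fin g → MvPolynomial (Fin g) ℝ) :
    spectrahedron (L.map (MvPolynomial.bind₁ π)) =
      (fun x i => MvPolynomial.eval x (π i)) ⁻¹' spectrahedron L := by
  ext x
  have h : (L.map (MvPolynomial.bind₁ π)).map (MvPolynomial.eval x) =
      L.map (MvPolynomial.eval fun i => MvPolynomial.eval x (π i)) := by
    ext s t
    exact eval_bind₁ π x (L s t)
  change ((L.map (MvPolynomial.bind₁ π)).map (MvPolynomial.eval x)).PosSemidef ↔ _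
  rw [h]
  rfl

theorem isLinearPencil_map_bind₁ {L : Matrix (Fin ν) (Fin ν) (MvPolynomial (Fin g) ℝ)}
    (hL : IsLinearPencil L) {π : Fin g → MvPolynomial (Fin g) ℝ}
    (hπ : ∀ i, (π i).totalDegree ≤ 1) : IsLinearPencil (L.map (MvPolynomial.bind₁ π)) :=
  ⟨by rw [← Matrix.transpose_map, hL.1], fun s t => totalDegree_bind₁_le_one hπ (hL.2 s t)⟩

theorem isLinearPencil_one : IsLinearPencil (1 : Matrix (Fin ν) (Fin ν) (MvPolynomial (Fin g) ℝ)) :=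
  ⟨Matrix.transpose_one, fun s t => by
    rw [Matrix.one_apply]
    split_ifs <;> simp⟩

theorem spectrahedron_one :
    spectrahedron (1 : Matrix (Fin ν) (Fin ν) (MvPolynomial (Fin g) ℝ)) = Set.univ := by
  refine Set.eq_univ_of_forall fun x => ?_
  have h : (1 : Matrix (Fin ν) (Fin ν) (MvPolynomial (Fin g) ℝ)).map (MvPolynomial.eval x) = 1 :=
    Matrix.map_one _ (map_zero _) (map_one _)
  change Matrix.PosSemidef _
  rw [h]
  exact Matrix.PosSemidef.one

end Spectrahedron

/-! ### The main theorem. -/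

/-- `L` is a commutative pencil and `L₀` any noncommutative pencil lifting it, for instance
`A₀ + ∑ᵢ ½ Aᵢ xᵢ + ∑ᵢ ½ Aᵢ xᵢ*` for `L = A₀ + ∑ᵢ Aᵢ xᵢ`. -/
theorem theorem1p8 (g ν : ℕ) (hν : 0 < ν)
    (L : Matrix (Fin ν) (Fin ν) (MvPolynomial (Fin g) ℝ)) (hL : IsLinearPencil L)
    (L₀ : Matrix (Fin ν) (Fin ν) (NCPoly g)) (hL₀ : IsNCLinearPencil L₀)
    (hlift : L₀.map collapse = L) :
    (∃ S : Set (MvPolynomial (Fin g) ℝ), (∀ f ∈ S, f.totalDegree ≤ 1) ∧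
      collapse '' (lRealRadical L₀ ⊥ : Set (NCPoly g)) =
        (Ideal.span S : Set (MvPolynomial (Fin g) ℝ))) ∧
    (∃ (ν' : ℕ) (Lt : Matrix (Fin ν') (Fin ν') (MvPolynomial (Fin g) ℝ)),
      0 < ν' ∧ ν' ≤ ν ∧ IsLinearPencil Lt ∧ (interior (spectrahedron Lt)).Nonempty ∧
      spectrahedron L =
        {x | x ∈ spectrahedron Lt ∧
          ∀ f ∈ collapse '' (lRealRadical L₀ ⊥ : Set (NCPoly g)), MvPolynomial.eval x f = 0}) := by
  subst hlift
  set R := lRealRadical L₀ ⊥ with hRdef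
  have hR : IsLReal L₀ R := isLReal_lRealRadical L₀ ⊥
  set U := affineCollapse R with hUdef
  have hU : ∀ u ∈ U, u.totalDegree ≤ 1 := fun u hu => totalDegree_le_of_mem_affineCollapse hu
  have himage : collapse '' (R : Set (NCPoly g)) = (R.map collapse : Set _) := by
    ext f
    exact mem_map_collapse.symm
  have hvan : ∀ f ∈ R.map collapse, ∀ x ∈ spectrahedron (L₀.map collapse),
      MvPolynomial.eval x f = 0 := by
    intro f hf x hx
    obtain ⟨r, hr, rfl⟩ := mem_map_collapse.1 hf
    exact eval_collapse_eq_zero_of_mem_lRealRadical hx hr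
  rw [himage]
  by_cases h1 : (1 : MvPolynomial (Fin g) ℝ) ∈ U
  · have htop : Ideal.span (U : Set (MvPolynomial (Fin g) ℝ)) = ⊤ :=
      (Ideal.eq_top_iff_one _).2 (Ideal.subset_span h1)
    have h1R : (1 : MvPolynomial (Fin g) ℝ) ∈ R.map collapse :=
      span_affineCollapse_le R (Ideal.subset_span h1)
    -- The spectrahedron is empty because `1` vanishes on it; on the right-hand side `1 ∈ I` already
    -- excludes every point.
    refine ⟨⟨U, hU, ?_⟩, ν, 1, hν, le_rfl, isLinearPencil_one, ?_, ?_⟩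
    · rw [htop, (Ideal.eq_top_iff_one _).2 h1R]
    · rw [spectrahedron_one, interior_univ]
      exact Set.univ_nonempty
    · ext x
      constructor
      · intro hx
        simpa using hvan 1 h1R x hx
      · rintro ⟨-, hx⟩
        simpa using hx 1 h1R
  · obtain ⟨O, hO, ⟨x₀, hx₀O, hx₀⟩, hOsub⟩ :=
      hR.exists_isOpen_inter_subset_spectrahedron hL₀ hL h1
    obtain ⟨π, hπdeg, hπmem, hπid⟩ := exists_affine_projection hU ⟨x₀, hx₀⟩
    have hπcont : Continuous fun x i => MvPolynomial.eval x (π i) :=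
      continuous_pi fun i => MvPolynomial.continuous_eval _
    have hopen : IsOpen ((fun x i => MvPolynomial.eval x (π i)) ⁻¹' O) := hO.preimage hπcont
    have hx₀' : x₀ ∈ (fun x i => MvPolynomial.eval x (π i)) ⁻¹' O := by
      rw [Set.mem_preimage, hπid x₀ hx₀]
      exact hx₀O
    have hXπ : ∀ i, MvPolynomial.X i - π i ∈
        Ideal.span (U : Set (MvPolynomial (Fin g) ℝ)) := by
      intro i
      refine Ideal.subset_span (mem_of_eval_eq_zero_on_commonZeros hU ⟨x₀, hx₀⟩ ?_ ?_)
      · exact (MvPolynomial.totalDegree_sub _ _).trans (max_le (by simp) (hπdeg i))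
      · intro x hx
        rw [map_sub, MvPolynomial.eval_X, congrFun (hπid x hx) i, sub_self]
    -- The pencil `L ∘ π` keeps the size `ν`, and its spectrahedron contains the open set `π⁻¹(O)`.
    refine ⟨⟨U, hU, ?_⟩, ν, (L₀.map collapse).map (MvPolynomial.bind₁ π), hν, le_rfl,
      isLinearPencil_map_bind₁ hL hπdeg, ⟨x₀, ?_⟩, ?_⟩
    · refine congrArg _ (le_antisymm (fun f hf => ?_) (span_affineCollapse_le R))
      have h0 : MvPolynomial.bind₁ π f = 0 :=
        eq_zero_of_eval_eq_zero_on_open hopen ⟨x₀, hx₀'⟩ fun x hx => by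
          rw [eval_bind₁]
          exact hvan f hf _ (hOsub ⟨hx, hπmem x⟩)
      simpa [h0] using sub_bind₁_mem hXπ f
    · rw [spectrahedron_map_bind₁]
      exact mem_interior.2 ⟨_, fun x hx => hOsub ⟨hx, hπmem x⟩, hopen, hx₀'⟩
    · rw [spectrahedron_map_bind₁]
      have hUR : ∀ u ∈ U, u ∈ R.map collapse := fun u hu =>
        span_affineCollapse_le R (Ideal.subset_span hu)
      ext x
      constructor
      · intro hx
        refine ⟨?_, fun f hf => hvan f hf x hx⟩
        -- Points where `I` vanishes lie in `Z`, where `π` is the identity and the two pencils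
        -- agree.
        rw [Set.mem_preimage, hπid x fun u hu => hvan u (hUR u hu) x hx]
        exact hx
      · rintro ⟨hx, hxR⟩
        rw [Set.mem_preimage, hπid x fun u hu => hxR u (hUR u hu)] at hx
        exact hx
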